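/- Let $G$ be a group, $\{H_\lambda\}_{\lambda\in\Lambda}$ a (possibly infinite) collection of subgroups of $G$, and $X\subseteq G$ a symmetric (possibly infinite) subset such that $G$ is generated by $X\cup\bigcup_\lambda H_\lambda$. Let $\Gamma=\Gamma(G,X\sqcup\mathcal H)$, where $\mathcal H=\bigsqcup_\lambda H_\lambda$, be the Cayley graph of $G$ whose edges are labelled by the letters of the alphabet $X\sqcup\mathcal H$ (the unions are disjoint, so an element of $G$ may be represented by several letters), and let $\mathrm d_{X\cup\mathcal H}$ be its graph metric on $G$. For $h,k\in H_\lambda$ let $\widehat{\mathrm d}_\lambda(h,k)\in[0,\infty]$ be the length of a shortest path from $h$ to $k$ in the graph obtained from $\Gamma$ by removing all edges that join two elements of $H_\lambda$ and are labelled by letters of the copy of $H_\lambda$ in $\mathcal H$. Suppose that $\{H_\lambda\}\hookrightarrow_h(G,X)$, that is, $\Gamma$ is hyperbolic (geodesic triangles are uniformly slim) and, for every $\lambda$, every ball of finite radius in $(H_\lambda,\widehat{\mathrm d}_\lambda)$ is finite. For every $\lambda$ let $\mathrm d_{H_\lambda}$ be a left-invariant metric on $H_\lambda$ with values in $\mathbb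 N\cup\{0\}$, and let $C=\{\mathrm d_{H_\lambda}\}_{\lambda\in\Lambda}$. Define $w_{C,X}\colon G\to\mathbb N\cup\{0,\infty\}$ by $w_{C,X}(1)=0$, $w_{C,X}(g)=1$ for $g\in X\setminus\{1\}$, $w_{C,X}(g)=\min\{\mathrm d_{H_\lambda}(1,g) : g\in H_\lambda\}$ if $g\notin X\cup\{1\}$ belongs to some $H_\lambda$, and $w_{C,X}(g)=\infty$ otherwise. The induced metric on $G$ is $$\mathrm d_{C,X}(f,g)=\min\Big\{\sum_{j=1}^k w_{C,X}(x_j)\ :\ x_1,\dots,x_k\in G,\ x_1\cdots x_k=f^{-1}g\Big\};$$ it is a left-invariant metric with values in $\mathbb N\cup\{0\}$. Then for every $\lambda\in\Lambda$, every nearest point projection $\pi_\lambda\colon G\to H_\lambda$, i.e. every map with $\mathrm d_{X\cup\mathcal H}(g,\pi_\lambda(g))=\min_{h\in H_\lambda}\mathrm d_{X\cup\mathcal H}(g,h)$ for all $g\in G$, is a Lipschitz map $(G,\mathrm d_{C,X})\to(H_\lambda,\mathrm d_{H_\lambda})$. Consequently $H_\lambda$ is a Lipschitz retract of $G$: there is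 a Lipschitz map $r\colon(G,\mathrm d_{C,X})\to(H_\lambda,\mathrm d_{H_\lambda})$ whose restriction to $H_\lambda$ is the identity; moreover, $r$ can be chosen $H_\lambda$-equivariant, i.e. $r(hg)=h\,r(g)$ for all $h\in H_\lambda$, $g\in G$. -/

import Mathlib

open scoped NNReal

namespace HypEmb

/-- An integer-valued left-invariant metric on a group `G`, with values in `{0, 1, 2, …}`. -/
structure IntMetric (G : Type*) [Group G] where
  dist : G → G → ℕ
  dist_eq_zero_iff : ∀ f g, dist f g = 0 ↔ f = g
  dist_comm : ∀ f g, dist f g = dist g f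
  dist_triangle : ∀ f g h, dist f h ≤ dist f g + dist g h
  dist_mul_left : ∀ f g h, dist (f * g) (f * h) = dist g h

/-- A map between groups is Lipschitz with respect to the given metrics. -/
def IsLipschitz {A B : Type*} [Group A] [Group B] (dA : IntMetric A) (dB : IntMetric B)
    (f : A → B) : Prop :=
  ∃ K : ℝ≥0, ∀ x y : A, (dB.dist (f x) (f y) : ℝ) ≤ (K : ℝ) * (dA.dist x y : ℝ)

/-- A walk in a graph is geodesic if its length is the distance between its endpoints. -/
def IsGeodesicWalk {V : Type*} {Γ : SimpleGraph V} {x y : V} (p : Γ.Walk x y) : Prop :=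
  (p.length : ℕ∞) = Γ.edist x y

/-- A graph is hyperbolic if, for some `δ`, all its geodesic triangles are `δ`-slim: every side is
contained in the `δ`-neighbourhood of the union of the two other sides. (The three sides can be
permuted cyclically, so it is enough to say this of the first one.) -/
def IsHyperbolicGraph {V : Type*} (Γ : SimpleGraph V) : Prop :=
  ∃ δ : ℕ, ∀ (x y z : V) (p : Γ.Walk x y) (q : Γ.Walk y z) (r : Γ.Walk z x),
    IsGeodesicWalk p → IsGeodesicWalk q → IsGeodesicWalk r →
      ∀ v ∈ p.support, ∃ w, (w ∈ q.support ∨ w ∈ r.support) ∧ Γ.edist v w ≤ δ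

section

variable {G : Type*} [Group G] {ι : Type*} (H : ι → Subgroup G) (X : Set G)

/-- The alphabet `X ⊔ ⨆ H i` (disjoint union, so an element of `G` may be represented by
several letters). -/
abbrev Letter : Type _ := X ⊕ (Σ i, H i)

/-- The element of `G` represented by a letter. -/
def letterVal : Letter H X → G
  | Sum.inl x => (x : G)
  | Sum.inr h => (h.2 : G)

/-- The Cayley graph `Γ(G, X ⊔ 𝓗)`: an edge goes from `g` to `g a` for every letter `a`. Only the
underlying simple graph is recorded; loops and multiplicities of edges do not affect paths between
vertices, their lengths or distances. -/
def cayley : SimpleGraph G :=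
  SimpleGraph.fromRel fun g h => ∃ a : Letter H X, g * letterVal H X a = h

/-- The graph `Δ_i`, obtained from `Γ(G, X ⊔ 𝓗)` by removing all edges (and no vertices) of the
complete subgraph `Γ(H i, H i)`: the edges that start in `H i` and are labelled by a letter of the
copy of `H i` in the alphabet. An edge between the same vertices that is labelled by a letter of
`X` or of another `H j` stays. -/
def deltaGraph (i : ι) : SimpleGraph G :=
  SimpleGraph.fromRel fun g h => ∃ a : Letter H X, g * letterVal H X a = h ∧
    ¬ (g ∈ H i ∧ ∃ b : H i, a = Sum.inr ⟨i, b⟩)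

/-- The extended metric `d_i : H i × H i → [0, ∞]`: the length of a shortest path in `Δ_i`. -/
noncomputable def relDist (i : ι) (h k : H i) : ℕ∞ :=
  (deltaGraph H X i).edist (h : G) (k : G)

/-- The set `X` generates `G` relative to the collection of subgroups `H i`. -/
def Generates : Prop :=
  Subgroup.closure (X ∪ ⋃ i, (H i : Set G)) = ⊤

/-- The collection `H` is hyperbolically embedded in `G` with respect to the symmetric set `X`. -/
structure IsHyperbolicallyEmbedded : Prop where
  symm : ∀ x ∈ X, x⁻¹ ∈ X
  generates : Generates H X
  hyperbolic : IsHyperbolicGraph (cayley H X)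
  proper : ∀ (i : ι) (h : H i) (n : ℕ), {k : H i | relDist H X i h k ≤ n}.Finite

/-- A nearest point projection of `G` to `H i`, for the metric of the Cayley graph
`Γ(G, X ⊔ 𝓗)`. -/
def IsNearestPointProjection (i : ι) (π : G → H i) : Prop :=
  ∀ (g : G) (h : H i), (cayley H X).edist g (π g : G) ≤ (cayley H X).edist g (h : G)

variable (C : ∀ i, IntMetric (H i))

open Classical in
/-- The weight function `w_{C,X}`. The last infimum is over all `i` with `g ∈ H i`; it is `∞` if
there is no such `i`. -/
noncomputable def weight (g : G) : ℕ∞ :=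
  if g = 1 then 0
  else if g ∈ X then 1
  else ⨅ (i : ι) (hg : g ∈ H i), ((C i).dist 1 ⟨g, hg⟩ : ℕ∞)

/-- The minimum of `w(x₁) + ⋯ + w(x_k)` over all decompositions `f⁻¹ g = x₁ ⋯ x_k`, where
`w = w_{C,X}`. -/
noncomputable def inducedEDist (f g : G) : ℕ∞ :=
  ⨅ (L : List G) (_ : L.prod = f⁻¹ * g), (L.map (weight H X C)).sum

theorem weight_one : weight H X C 1 = 0 := by simp [weight]

theorem weight_eq_zero {g : G} (h : weight H X C g = 0) : g = 1 := by
  by_contra hg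
  by_cases hX : g ∈ X
  · simp [weight, hg, hX] at h
  · have h1 : (1 : ℕ∞) ≤ weight H X C g := by
      simp only [weight, hg, hX, if_false]
      refine le_iInf fun i => le_iInf fun hi => ?_
      have : (C i).dist 1 ⟨g, hi⟩ ≠ 0 := by
        intro h0
        exact hg (congrArg Subtype.val (((C i).dist_eq_zero_iff _ _).1 h0)).symm
      exact_mod_cast Nat.one_le_iff_ne_zero.2 this
    rw [h] at h1
    exact absurd h1 (by simp)

theorem weight_inv_le (hX : ∀ x ∈ X, x⁻¹ ∈ X) (g : G) :
    weight H X C g⁻¹ ≤ weight H X C g := by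
  by_cases h1 : g = 1
  · simp [h1]
  by_cases h2 : g ∈ X
  · simp [weight, h1, h2, hX g h2]
  have h2' : g⁻¹ ∉ X := fun h => h2 (by simpa using hX _ h)
  simp only [weight, h1, h2, h2', inv_eq_one, if_false]
  refine le_iInf fun i => le_iInf fun hi => ?_
  refine (iInf_le_of_le i (iInf_le_of_le ((H i).inv_mem hi) ?_))
  have := (C i).dist_mul_left ⟨g, hi⟩ 1 ⟨g⁻¹, (H i).inv_mem hi⟩
  have e : (⟨g, hi⟩ : H i) * ⟨g⁻¹, (H i).inv_mem hi⟩ = 1 := by ext; simp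
  rw [e, mul_one, (C i).dist_comm] at this
  rw [this]

theorem exists_list (f g : G) : ∃ L : List G, L.prod = f⁻¹ * g ∧
    inducedEDist H X C f g = (L.map (weight H X C)).sum := by
  have hne : Nonempty {L : List G // L.prod = f⁻¹ * g} := ⟨⟨[f⁻¹ * g], by simp⟩⟩
  obtain ⟨L, hL⟩ := ciInf_mem
    (fun L : {L : List G // L.prod = f⁻¹ * g} => (L.1.map (weight H X C)).sum)
  refine ⟨L.1, L.2, ?_⟩
  rw [inducedEDist, iInf_subtype']
  exact hL.symm

theorem inducedEDist_le {f g : G} {L : List G} (hL : L.prod = f⁻¹ * g) :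
    inducedEDist H X C f g ≤ (L.map (weight H X C)).sum :=
  iInf_le_of_le L (iInf_le_of_le hL le_rfl)

theorem inducedEDist_mul_left (f g h : G) :
    inducedEDist H X C (f * g) (f * h) = inducedEDist H X C g h := by
  simp [inducedEDist, mul_assoc]

theorem inducedEDist_triangle (f g h : G) :
    inducedEDist H X C f h ≤ inducedEDist H X C f g + inducedEDist H X C g h := by
  obtain ⟨L, hL, eL⟩ := exists_list H X C f g
  obtain ⟨M, hM, eM⟩ := exists_list H X C g h
  rw [eL, eM, ← List.sum_append, ← List.map_append]
  exact inducedEDist_le H X C (by simp [hL, hM, mul_assoc])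

theorem inducedEDist_self (f : G) : inducedEDist H X C f f = 0 :=
  le_antisymm ((inducedEDist_le H X C (L := []) (by simp)).trans (by simp)) zero_le

theorem eq_of_inducedEDist_eq_zero {f g : G} (h : inducedEDist H X C f g = 0) : f = g := by
  obtain ⟨L, hL, eL⟩ := exists_list H X C f g
  rw [h, eq_comm, List.sum_eq_zero_iff] at eL
  have : L.prod = 1 := List.prod_eq_one fun x hx =>
    weight_eq_zero H X C (eL _ (List.mem_map_of_mem hx))
  rw [this] at hL
  exact inv_mul_eq_one.1 hL.symm

theorem inducedEDist_comm_le (hX : ∀ x ∈ X, x⁻¹ ∈ X) (f g : G) :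
    inducedEDist H X C f g ≤ inducedEDist H X C g f := by
  obtain ⟨L, hL, eL⟩ := exists_list H X C g f
  rw [eL]
  refine (inducedEDist_le H X C (L := (L.map (·⁻¹)).reverse) ?_).trans ?_
  · rw [← List.prod_inv_reverse, hL]; simp
  · rw [List.map_reverse, List.sum_reverse, List.map_map]
    exact List.sum_le_sum fun x _ => weight_inv_le H X C hX x

theorem inducedEDist_comm (hX : ∀ x ∈ X, x⁻¹ ∈ X) (f g : G) :
    inducedEDist H X C f g = inducedEDist H X C g f :=
  le_antisymm (inducedEDist_comm_le H X C hX f g) (inducedEDist_comm_le H X C hX g f)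

theorem inducedEDist_ne_top (hX : ∀ x ∈ X, x⁻¹ ∈ X) (hgen : Generates H X) (f g : G) :
    inducedEDist H X C f g ≠ ⊤ := by
  have key : ∀ x : G, inducedEDist H X C 1 x ≠ ⊤ := by
    intro x
    have hx : x ∈ Subgroup.closure (X ∪ ⋃ i, (H i : Set G)) := by
      rw [hgen]; exact Subgroup.mem_top x
    induction hx using Subgroup.closure_induction with
    | mem x hx =>
      have hw : weight H X C x ≠ ⊤ := by
        by_cases h1 : x = 1
        · simp [weight, h1]
        by_cases h2 : x ∈ X
        · simp [weight, h1, h2]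
        obtain ⟨i, hi⟩ : ∃ i, x ∈ H i := by simpa [h2] using hx
        simp only [weight, h1, h2, if_false]
        exact ne_top_of_le_ne_top (ENat.natCast_ne_top _) (iInf_le_of_le i (iInf_le _ hi))
      exact ne_top_of_le_ne_top hw
        ((inducedEDist_le H X C (L := [x]) (by simp)).trans (by simp))
    | one => simp [inducedEDist_self]
    | mul x y _ _ hx hy =>
      refine ne_top_of_le_ne_top ?_ (inducedEDist_triangle H X C 1 x (x * y))
      have := inducedEDist_mul_left H X C x 1 y
      rw [mul_one] at this
      rw [this]
      exact WithTop.add_ne_top.2 ⟨hx, hy⟩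
    | inv x _ hx =>
      have := inducedEDist_mul_left H X C x 1 x⁻¹
      rw [mul_one, mul_inv_cancel, inducedEDist_comm H X C hX] at this
      rwa [← this]
  have := inducedEDist_mul_left H X C f 1 (f⁻¹ * g)
  rw [mul_one, mul_inv_cancel_left] at this
  rw [this]
  exact key _

/-- The metric `d_{C,X}` on `G` induced by the collection `C` of metrics on the subgroups `H i`,
for a symmetric relative generating set `X`. -/
noncomputable def inducedMetric (hX : ∀ x ∈ X, x⁻¹ ∈ X) (hgen : Generates H X) : IntMetric G where
  dist f g := (inducedEDist H X C f g).toNat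
  dist_eq_zero_iff f g := by
    rw [ENat.toNat_eq_zero]
    constructor
    · rintro (h | h)
      · exact eq_of_inducedEDist_eq_zero H X C h
      · exact absurd h (inducedEDist_ne_top H X C hX hgen f g)
    · rintro rfl
      exact Or.inl (inducedEDist_self H X C f)
  dist_comm f g := by rw [inducedEDist_comm H X C hX]
  dist_triangle f g h := by
    have h1 := inducedEDist_ne_top H X C hX hgen f g
    have h2 := inducedEDist_ne_top H X C hX hgen g h
    rw [← ENat.toNat_add h1 h2]
    exact ENat.toNat_le_toNat (inducedEDist_triangle H X C f g h) (WithTop.add_ne_top.2 ⟨h1, h2⟩)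
  dist_mul_left f g h := by rw [inducedEDist_mul_left]

end

end HypEmb

namespace HypEmb

/-! ### Nearest points to a small set in a slim graph. -/

section Graph

variable {V : Type*} {Γ Δ : SimpleGraph V} {S : Set V}

/-! By the triangle inequality along a cheapest decomposition of `f⁻¹ * g`, it suffices to bound the
displacement of `π g` when `g` is multiplied by a single `x`, by a constant times the weight of `x`
(`exists_dist_le_weight`). There are two kinds of edges from `g` to `g * x`.

If the edge is labelled by the copy of `H i` and starts in `H i`, then `π` fixes both ends, and the
displacement is exactly the weight.

Every other edge survives in `Δ_i`. The geodesics from its ends to their projections meet `H i` only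
at their last vertices, so they survive too. If they are long, slimness gives a short bridge between
them, still away from `H i`. Either way the projections are joined in `Δ_i` by a path of length at
most `8 * δ + 8` (`edist_nearest_le`). Balls of the relative metric are finite, and left translation
by `H i` moves them all to the identity, so the displacement in `H i` is bounded
(`exists_dist_le_of_relDist_le`); nontrivial elements have weight at least `1`.

A nearest point projection fixes `H i` pointwise, hence is a retraction. An equivariant one is made
by choosing values on coset representatives. -/

theorem isGeodesicWalk_iff (hc : Γ.Connected) {x y : V} (p : Γ.Walk x y) :
    IsGeodesicWalk p ↔ p.length = Γ.dist x y := by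
  rw [IsGeodesicWalk, ← (hc x y).coe_dist_eq_edist, Nat.cast_inj]

theorem IsGeodesicWalk.dist_add_dist (hc : Γ.Connected) {x y v : V} {p : Γ.Walk x y}
    (hp : IsGeodesicWalk p) (hv : v ∈ p.support) :
    Γ.dist x v + Γ.dist v y = Γ.dist x y := by
  classical
  have h1 := (isGeodesicWalk_iff hc p).1 hp
  have h2 := congrArg SimpleGraph.Walk.length (p.take_spec hv)
  rw [SimpleGraph.Walk.length_append] at h2
  have h3 := SimpleGraph.dist_le (p.takeUntil v hv)
  have h4 := SimpleGraph.dist_le (p.dropUntil v hv)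
  have h5 := hc.dist_triangle (u := x) (v := v) (w := y)
  omega

theorem exists_isGeodesicWalk_of_dist_add_dist (hc : Γ.Connected) {x y v : V}
    (h : Γ.dist x v + Γ.dist v y = Γ.dist x y) :
    ∃ p : Γ.Walk x y, IsGeodesicWalk p ∧ v ∈ p.support := by
  obtain ⟨p, hp⟩ := hc.exists_walk_length_eq_dist x v
  obtain ⟨q, hq⟩ := hc.exists_walk_length_eq_dist v y
  refine ⟨p.append q, ?_, by simp⟩
  rw [isGeodesicWalk_iff hc, SimpleGraph.Walk.length_append, hp, hq, h]

theorem exists_isGeodesicWalk (hc : Γ.Connected) (x y : V) :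
    ∃ p : Γ.Walk x y, IsGeodesicWalk p := by
  obtain ⟨p, hp⟩ := hc.exists_walk_length_eq_dist x y
  exact ⟨p, (isGeodesicWalk_iff hc p).2 hp⟩

/-- Slimness of geodesic triangles, in terms of distances only. -/
def IsSlim (Γ : SimpleGraph V) (δ : ℕ) : Prop :=
  ∀ x y z v : V, Γ.dist x v + Γ.dist v y = Γ.dist x y →
    ∃ w, (Γ.dist y w + Γ.dist w z = Γ.dist y z ∨ Γ.dist z w + Γ.dist w x = Γ.dist z x) ∧
      Γ.dist v w ≤ δ

theorem IsHyperbolicGraph.exists_isSlim (hc : Γ.Connected) (h : IsHyperbolicGraph Γ) :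
    ∃ δ, IsSlim Γ δ := by
  obtain ⟨δ, hδ⟩ := h
  refine ⟨δ, fun x y z v hv => ?_⟩
  obtain ⟨p, hp, hvp⟩ := exists_isGeodesicWalk_of_dist_add_dist hc hv
  obtain ⟨q, hq⟩ := exists_isGeodesicWalk hc y z
  obtain ⟨r, hr⟩ := exists_isGeodesicWalk hc z x
  obtain ⟨w, hw, hvw⟩ := hδ x y z p q r hp hq hr v hvp
  refine ⟨w, hw.imp (hq.dist_add_dist hc) (hr.dist_add_dist hc), ?_⟩
  rw [← (hc v w).coe_dist_eq_edist] at hvw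
  exact_mod_cast hvw

theorem exists_dist_eq (hc : Γ.Connected) {x y : V} {k : ℕ} (hk : k ≤ Γ.dist x y) :
    ∃ v, Γ.dist x v = k ∧ k + Γ.dist v y = Γ.dist x y := by
  obtain ⟨p, hp⟩ := hc.exists_walk_length_eq_dist x y
  have h1 := SimpleGraph.dist_le (p.take k)
  have h2 := SimpleGraph.dist_le (p.drop k)
  rw [SimpleGraph.Walk.take_length] at h1
  rw [SimpleGraph.Walk.drop_length] at h2
  have h3 := hc.dist_triangle (u := x) (v := p.getVert k) (w := y)
  exact ⟨p.getVert k, by omega, by omega⟩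

theorem exists_adj_dist_eq (hc : Γ.Connected) {x y : V} {n : ℕ} (h : Γ.dist x y = n + 1) :
    ∃ u, Γ.Adj x u ∧ Γ.dist u y = n := by
  obtain ⟨u, h1, h2⟩ := exists_dist_eq hc (show 1 ≤ Γ.dist x y by omega)
  exact ⟨u, SimpleGraph.dist_eq_one_iff_adj.1 h1, by omega⟩

/-- A geodesic that stays away from `S`, except possibly at its endpoint, survives in every graph
that keeps the edges not contained in `S`. -/
theorem edist_le_of_dist_eq (hc : Γ.Connected)
    (hΔ : ∀ u v, Γ.Adj u v → ¬ (u ∈ S ∧ v ∈ S) → Δ.Adj u v) {v : V} :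
    ∀ {n : ℕ} {u : V}, Γ.dist u v = n → (∀ s ∈ S, n ≤ Γ.dist u s) → Δ.edist u v ≤ n := by
  intro n
  induction n with
  | zero =>
    intro u h _
    rw [(hc.dist_eq_zero_iff).1 h]
    simp
  | succ n ih =>
    intro u h hS
    obtain ⟨w, huw, hwv⟩ := exists_adj_dist_eq hc h
    -- Only the last vertex of the geodesic can lie in `S`: a vertex of `S` is at distance `0` from
    -- `S`, while `n + 1` steps remain.
    have hu : u ∉ S := fun hu => by simpa using hS u hu
    have h1 : Δ.edist u w ≤ 1 :=
      (SimpleGraph.edist_eq_one_iff_adj.2 (hΔ u w huw fun h => hu h.1)).le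
    have h2 : Δ.edist w v ≤ n := ih hwv fun s hs => by
      have h3 := hc.dist_triangle (u := u) (v := w) (w := s)
      have h4 := hS s hs
      rw [SimpleGraph.dist_eq_one_iff_adj.2 huw] at h3
      omega
    calc Δ.edist u v ≤ Δ.edist u w + Δ.edist w v := SimpleGraph.edist_triangle
      _ ≤ 1 + n := add_le_add h1 h2
      _ = ((n + 1 : ℕ) : ℕ∞) := by push_cast; ring

/-- In a slim graph `Γ`, let `S` be a subset of diameter at most `1`, and let `Δ` be a graph that
keeps the edges of `Γ` not contained in `S`. Then points of `S` nearest to the two ends of an edge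
common to `Γ` and `Δ` are uniformly close to each other in `Δ`. -/
theorem edist_nearest_le (hc : Γ.Connected) {δ : ℕ} (hδ : IsSlim Γ δ)
    (hΔ : ∀ u v, Γ.Adj u v → ¬ (u ∈ S ∧ v ∈ S) → Δ.Adj u v)
    (hS : ∀ s ∈ S, ∀ t ∈ S, Γ.dist s t ≤ 1) {a b g g' : V} (ha : a ∈ S) (hb : b ∈ S)
    (hga : ∀ s ∈ S, Γ.dist g a ≤ Γ.dist g s) (hgb : ∀ s ∈ S, Γ.dist g' b ≤ Γ.dist g' s)
    (hgg : Γ.dist g g' ≤ 1) (hgg' : Δ.edist g g' ≤ 1) :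
    Δ.edist a b ≤ (8 * δ + 8 : ℕ) := by
  have nearest : ∀ {g a v : V}, (∀ s ∈ S, Γ.dist g a ≤ Γ.dist g s) →
      Γ.dist g v + Γ.dist v a = Γ.dist g a → ∀ s ∈ S, Γ.dist v a ≤ Γ.dist v s := by
    intro g a v h hv s hs
    have h1 := hc.dist_triangle (u := g) (v := v) (w := s)
    have h2 := h s hs
    omega
  have tri : ∀ u v w : V, Γ.dist u w ≤ Γ.dist u v + Γ.dist v w :=
    fun u v w => hc.dist_triangle
  have sym : ∀ u v : V, Γ.dist u v = Γ.dist v u := fun u v => SimpleGraph.dist_comm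
  -- All paths used have the shape `a`, `v`, `w`, `b`, with a bridge of length at most `m` in the
  -- middle.
  have path : ∀ {v w : V}, Δ.edist v a ≤ Γ.dist v a → Δ.edist w b ≤ Γ.dist w b → ∀ m : ℕ,
      Δ.edist v w ≤ m → Γ.dist v a + m + Γ.dist w b ≤ 8 * δ + 8 →
      Δ.edist a b ≤ (8 * δ + 8 : ℕ) := by
    intro v w h1 h2 m h3 h4
    calc Δ.edist a b ≤ Δ.edist a v + Δ.edist v b := SimpleGraph.edist_triangle
      _ ≤ Δ.edist a v + (Δ.edist v w + Δ.edist w b) := by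
          gcongr; exact SimpleGraph.edist_triangle
      _ ≤ Γ.dist v a + (m + Γ.dist w b) := by
          rw [SimpleGraph.edist_comm]; gcongr
      _ ≤ (8 * δ + 8 : ℕ) := by rw [← add_assoc]; exact_mod_cast h4
  have hab := hS a ha b hb
  have hb' := hgb a ha
  have t1 := tri g' g a
  have s1 := sym g g'
  -- Short case: the edge itself is the bridge, and the length is at most `(4 * δ + 3) + 1 + (4 * δ
  -- + 4)`.
  by_cases hn : Γ.dist g a ≤ 4 * δ + 3
  · exact path (edist_le_of_dist_eq hc hΔ rfl hga) (edist_le_of_dist_eq hc hΔ rfl hgb) 1 hgg'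
      (by omega)
  -- The point `v` is at distance at least `2 * δ + 2` from both `a` and `g`. So it is not `δ`-close
  -- to a geodesic from `b` to `a`, nor `2 * δ`-close to one from `g'` to `g`; two slim triangles
  -- then put a point `w` between `b` and `g'` within `2 * δ` of `v`.
  obtain ⟨v, hv1, hv2⟩ := exists_dist_eq (x := a) (y := g) hc (k := 2 * δ + 2)
    (by rw [sym]; omega)
  have s2 := sym a v
  have s3 := sym a g
  have s4 := sym g v
  have hva := nearest hga (v := v) (by omega)
  obtain ⟨w₁, hw₁, hvw₁⟩ := hδ a g b v (by omega)
  rcases hw₁ with hw₁ | hw₁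
  swap
  · have := tri v w₁ a
    have := sym a b
    omega
  obtain ⟨w, hw, hww⟩ := hδ g b g' w₁ hw₁
  have t2 := tri v w₁ w
  rcases hw with hw | hw
  swap
  · have := tri v w g
    omega
  have s5 := sym b w
  have s6 := sym b g'
  have s7 := sym w g'
  have hwb := nearest hgb (v := w) (by omega)
  have hwa := hwb a ha
  have t3 := tri w v a
  have s8 := sym v w
  refine path (v := v) (w := w) (edist_le_of_dist_eq hc hΔ rfl hva)
    (edist_le_of_dist_eq hc hΔ rfl hwb) (Γ.dist v w) ?_ (by omega)
  -- The bridge avoids `S`: its length is at most `2 * δ`, while `v` is at distance at least `2 * δ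
  -- + 2` from `S`.
  refine edist_le_of_dist_eq hc hΔ rfl fun s hs => ?_
  have := hva s hs
  omega

end Graph

/-! ### Cayley graphs, projections to `H i` and the Lipschitz estimate. -/

section Cayley

variable {G : Type*} [Group G] {ι : Type*} (H : ι → Subgroup G) (X : Set G)

theorem cayley_adj_mul_left (k : G) {g h : G} (hgh : (cayley H X).Adj g h) :
    (cayley H X).Adj (k * g) (k * h) := by
  simpa [cayley, SimpleGraph.fromRel_adj, mul_assoc] using hgh

theorem deltaGraph_adj_mul_left {i : ι} {k : G} (hk : k ∈ H i) {g h : G}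
    (hgh : (deltaGraph H X i).Adj g h) : (deltaGraph H X i).Adj (k * g) (k * h) := by
  simpa [deltaGraph, SimpleGraph.fromRel_adj, mul_assoc, (H i).mul_mem_cancel_left hk] using hgh

theorem edist_map_le {V : Type*} {Γ : SimpleGraph V} (f : V → V)
    (hf : ∀ u v, Γ.Adj u v → Γ.Adj (f u) (f v)) (u v : V) :
    Γ.edist (f u) (f v) ≤ Γ.edist u v := by
  by_cases h : Γ.Reachable u v
  · obtain ⟨p, hp⟩ := h.exists_walk_length_eq_edist
    rw [← hp]
    refine (SimpleGraph.edist_le (p.map (⟨f, fun {a b} h => hf a b h⟩ : Γ →g Γ))).trans ?_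
    simp
  · simp [SimpleGraph.edist_eq_top_of_not_reachable h]

theorem cayley_edist_mul_left (k g h : G) :
    (cayley H X).edist (k * g) (k * h) = (cayley H X).edist g h := by
  refine le_antisymm (edist_map_le _ (fun _ _ => cayley_adj_mul_left H X k) g h) ?_
  simpa using edist_map_le _ (fun _ _ => cayley_adj_mul_left H X k⁻¹) (k * g) (k * h)

theorem relDist_mul_left (i : ι) (k g h : H i) :
    relDist H X i (k * g) (k * h) = relDist H X i g h := by
  have key : ∀ k g h : H i, relDist H X i (k * g) (k * h) ≤ relDist H X i g h := fun k g h =>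
    edist_map_le _ (fun _ _ => deltaGraph_adj_mul_left H X k.2) (g : G) (h : G)
  refine le_antisymm (key k g h) ?_
  simpa using key k⁻¹ (k * g) (k * h)

theorem cayley_adj_of_letter {g h : G} (hne : g ≠ h) (a : Letter H X)
    (ha : g * letterVal H X a = h) : (cayley H X).Adj g h :=
  (SimpleGraph.fromRel_adj _ _ _).2 ⟨hne, Or.inl ⟨a, ha⟩⟩

theorem deltaGraph_adj_of_cayley_adj {i : ι} {g h : G} (hgh : (cayley H X).Adj g h)
    (hi : ¬ (g ∈ H i ∧ h ∈ H i)) : (deltaGraph H X i).Adj g h := by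
  have key : ∀ {g h : G}, ¬ (g ∈ H i ∧ h ∈ H i) → (∃ a : Letter H X, g * letterVal H X a = h) →
      ∃ a : Letter H X, g * letterVal H X a = h ∧ ¬ (g ∈ H i ∧ ∃ b : H i, a = Sum.inr ⟨i, b⟩) := by
    rintro g h hi ⟨a, ha⟩
    refine ⟨a, ha, ?_⟩
    rintro ⟨hg, b, rfl⟩
    exact hi ⟨hg, ha ▸ (H i).mul_mem hg b.2⟩
  obtain ⟨hne, hgh⟩ := (SimpleGraph.fromRel_adj _ _ _).1 hgh
  exact (SimpleGraph.fromRel_adj _ _ _).2 ⟨hne, hgh.imp (key hi) (key fun h => hi h.symm)⟩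

theorem cayley_edist_le_one {i : ι} {g h : G} (hgh : g⁻¹ * h ∈ H i) :
    (cayley H X).edist g h ≤ 1 := by
  rw [SimpleGraph.edist_le_one_iff_adj_or_eq]
  by_cases hne : g = h
  · exact Or.inr hne
  · exact Or.inl (cayley_adj_of_letter H X hne (Sum.inr ⟨i, ⟨_, hgh⟩⟩) (by simp [letterVal]))

theorem cayley_connected (hgen : Generates H X) : (cayley H X).Connected := by
  have key : ∀ x g : G, (cayley H X).Reachable g (g * x) := by
    intro x
    have hx : x ∈ Subgroup.closure (X ∪ ⋃ i, (H i : Set G)) := by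
      rw [hgen]; exact Subgroup.mem_top x
    induction hx using Subgroup.closure_induction with
    | mem x hx =>
      intro g
      obtain ⟨a, rfl⟩ : ∃ a : Letter H X, letterVal H X a = x := by
        rcases hx with hx | hx
        · exact ⟨Sum.inl ⟨x, hx⟩, rfl⟩
        · obtain ⟨i, hi⟩ := Set.mem_iUnion.1 hx
          exact ⟨Sum.inr ⟨i, ⟨x, hi⟩⟩, rfl⟩
      by_cases hne : g = g * letterVal H X a
      · rw [← hne]
      · exact (cayley_adj_of_letter H X hne a rfl).reachable
    | one => intro g; simp
    | mul x y _ _ hx hy => intro g; simpa [mul_assoc] using (hx g).trans (hy (g * x))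
    | inv x _ hx => intro g; simpa using (hx (g * x⁻¹)).symm
  have : Nonempty G := ⟨1⟩
  exact ⟨fun g h => by simpa using key (g⁻¹ * h) g⟩

variable {H X}

theorem IsNearestPointProjection.apply_coe {i : ι} {π : G → H i}
    (hπ : IsNearestPointProjection H X i π) (h : H i) : π (h : G) = h := by
  have := hπ h h
  rw [SimpleGraph.edist_self, nonpos_iff_eq_zero, SimpleGraph.edist_eq_zero_iff] at this
  exact Subtype.ext this.symm

/-- Nearest point projections move the ends of an edge of `Δ i` to elements of `H i` at bounded
relative distance. -/
theorem IsHyperbolicallyEmbedded.exists_relDist_le (hyp : IsHyperbolicallyEmbedded H X) (i : ι) :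
    ∃ N : ℕ, ∀ π : G → H i, IsNearestPointProjection H X i π → ∀ g g' : G,
      (cayley H X).edist g g' ≤ 1 → (deltaGraph H X i).edist g g' ≤ 1 →
        relDist H X i (π g) (π g') ≤ N := by
  have hc := cayley_connected H X hyp.generates
  have hcoe : ∀ u v, ((cayley H X).dist u v : ℕ∞) = (cayley H X).edist u v :=
    fun u v => (hc u v).coe_dist_eq_edist
  obtain ⟨δ, hδ⟩ := hyp.hyperbolic.exists_isSlim hc
  refine ⟨8 * δ + 8, fun π hπ g g' h1 h2 => ?_⟩
  have near : ∀ g, ∀ s ∈ (H i : Set G), (cayley H X).dist g (π g) ≤ (cayley H X).dist g s := by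
    intro g s hs
    have := hπ g ⟨s, hs⟩
    rw [← hcoe, ← hcoe] at this
    exact_mod_cast this
  refine edist_nearest_le (S := (H i : Set G)) hc hδ
    (fun u v => deltaGraph_adj_of_cayley_adj H X) ?_ (π g).2 (π g').2 (near g) (near g') ?_ h2
  · intro s hs t ht
    have := cayley_edist_le_one H X ((H i).mul_mem ((H i).inv_mem hs) ht)
    rw [← hcoe] at this
    exact_mod_cast this
  · rw [← hcoe] at h1
    exact_mod_cast h1

variable (H X) in
theorem exists_isNearestPointProjection (i : ι) :
    ∃ π : G → H i, IsNearestPointProjection H X i π := by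
  have : ∀ g : G, ∃ k : H i, ∀ h : H i, (cayley H X).edist g k ≤ (cayley H X).edist g h := by
    intro g
    obtain ⟨k, hk⟩ := ciInf_mem fun k : H i => (cayley H X).edist g k
    exact ⟨k, fun h => hk.le.trans (iInf_le _ h)⟩
  choose π hπ using this
  exact ⟨π, hπ⟩

variable (H X) in
-- Left translation by `H i` is an isometry preserving `H i`, so a projection may be prescribed on
-- one representative of each coset `H i * g` and translated. The action of `H i` on `G` is free, so
-- this is consistent.
theorem exists_equivariant_isNearestPointProjection (i : ι) :
    ∃ r : G → H i, IsNearestPointProjection H X i r ∧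
      ∀ (h : H i) (g : G), r ((h : G) * g) = h * r g := by
  obtain ⟨π, hπ⟩ := exists_isNearestPointProjection H X i
  let rep : G → G := fun g => (Quotient.mk (QuotientGroup.rightRel (H i)) g).out
  have hrep : ∀ g, g * (rep g)⁻¹ ∈ H i := fun g =>
    QuotientGroup.rightRel_apply.1 (Quotient.exact (Quotient.out_eq _))
  have hmul : ∀ (h : H i) (g : G), rep (h * g) = rep g := fun h g =>
    congrArg Quotient.out (Quotient.sound (QuotientGroup.rightRel_apply.2 (by simp)))
  refine ⟨fun g => ⟨_, hrep g⟩ * π (rep g), fun g h => ?_, fun h g => ?_⟩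
  · have := hπ (rep g) (⟨_, hrep g⟩⁻¹ * h)
    rw [← cayley_edist_mul_left H X (g * (rep g)⁻¹),
      ← cayley_edist_mul_left H X (g * (rep g)⁻¹) (rep g)] at this
    simpa [mul_assoc] using this
  · ext
    simp [hmul, mul_assoc]

variable (C : ∀ i, IntMetric (H i))

/-- Both metrics are left-invariant, so only the finite relative ball around `1` matters. -/
theorem exists_dist_le_of_relDist_le (hyp : IsHyperbolicallyEmbedded H X) (i : ι) (N : ℕ) :
    ∃ K : ℕ, ∀ h k : H i, relDist H X i h k ≤ N → (C i).dist h k ≤ K := by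
  obtain ⟨K, hK⟩ := ((hyp.proper i 1 N).image ((C i).dist 1)).bddAbove
  refine ⟨K, fun h k hhk => ?_⟩
  have h1 : relDist H X i 1 (h⁻¹ * k) ≤ N := by
    rw [← relDist_mul_left H X i h]
    simpa using hhk
  have h2 : (C i).dist 1 (h⁻¹ * k) ≤ K := hK ⟨_, h1, rfl⟩
  rw [← (C i).dist_mul_left h] at h2
  simpa using h2

/-- An element of finite weight is either trivial, or a letter of `X` of weight `1`, or a letter of
one of the subgroups whose length there is its weight. -/
theorem weight_cases {x : G} (hx : weight H X C x ≠ ⊤) :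
    x = 1 ∨ (x ∈ X ∧ weight H X C x = 1) ∨
      ∃ (j : ι) (h : x ∈ H j), weight H X C x = (C j).dist 1 ⟨x, h⟩ := by
  by_cases h1 : x = 1
  · exact Or.inl h1
  by_cases h2 : x ∈ X
  · exact Or.inr (Or.inl ⟨h2, by simp [weight, h1, h2]⟩)
  right; right
  have hw : weight H X C x = ⨅ p : {j : ι // x ∈ H j}, ((C p.1).dist 1 ⟨x, p.2⟩ : ℕ∞) := by
    simp only [weight, h1, h2, if_false, iInf_subtype]
  have : Nonempty {j : ι // x ∈ H j} := by
    by_contra hne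
    rw [not_nonempty_iff] at hne
    exact hx (by rw [hw, iInf_of_empty])
  obtain ⟨p, hp⟩ := ciInf_mem fun p : {j : ι // x ∈ H j} => ((C p.1).dist 1 ⟨x, p.2⟩ : ℕ∞)
  exact ⟨p.1, p.2, hw.trans hp.symm⟩

theorem IsHyperbolicallyEmbedded.exists_dist_le_weight (hyp : IsHyperbolicallyEmbedded H X)
    (i : ι) : ∃ K : ℕ, ∀ π : G → H i, IsNearestPointProjection H X i π → ∀ g x : G,
      ((C i).dist (π g) (π (g * x)) : ℕ∞) ≤ (K + 1 : ℕ) * weight H X C x := by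
  obtain ⟨N, hN⟩ := hyp.exists_relDist_le i
  obtain ⟨K, hK⟩ := exists_dist_le_of_relDist_le C hyp i N
  refine ⟨K, fun π hπ g x => ?_⟩
  by_cases h1 : x = 1
  · simp [h1, ((C i).dist_eq_zero_iff _ _).2]
  by_cases hx : weight H X C x = ⊤
  · rw [hx, ENat.mul_top (by simp)]
    exact le_top
  have hw : 1 ≤ weight H X C x := Order.one_le_iff_ne_zero.2 fun h => h1 (weight_eq_zero H X C h)
  have hne : g ≠ g * x := fun h => h1 (by simpa using h)
  -- The edge survives in `Δ_i`, so the displacement is at most `K`, and the weight is at least `1`.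
  have of_letter : ∀ a : Letter H X, letterVal H X a = x →
      ¬ (g ∈ H i ∧ ∃ b : H i, a = Sum.inr ⟨i, b⟩) →
      ((C i).dist (π g) (π (g * x)) : ℕ∞) ≤ (K + 1 : ℕ) * weight H X C x := by
    intro a ha hi
    have hadj : (cayley H X).Adj g (g * x) := cayley_adj_of_letter H X hne a (by rw [ha])
    have hadj' : (deltaGraph H X i).Adj g (g * x) :=
      (SimpleGraph.fromRel_adj _ _ _).2 ⟨hne, Or.inl ⟨a, by rw [ha], hi⟩⟩
    have := hK _ _ (hN π hπ g (g * x) (SimpleGraph.edist_eq_one_iff_adj.2 hadj).le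
      (SimpleGraph.edist_eq_one_iff_adj.2 hadj').le)
    calc ((C i).dist (π g) (π (g * x)) : ℕ∞) ≤ (K + 1 : ℕ) := by exact_mod_cast this.trans (by simp)
      _ = (K + 1 : ℕ) * 1 := (mul_one _).symm
      _ ≤ (K + 1 : ℕ) * weight H X C x := by gcongr
  rcases weight_cases C hx with h | ⟨h, -⟩ | ⟨j, hj, hwj⟩
  · exact absurd h h1
  · exact of_letter (Sum.inl ⟨x, h⟩) rfl (by simp)
  -- What matters is the subgroup `H j` that realises the weight: if `j ≠ i`, the edge stays in
  -- `Δ_i` even when `x` also lies in `H i`. In the case `j = i` the displacement equals the weight,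
  -- and `K + 1` rather than `K` ensures a factor of at least `1`.
  · by_cases hg : g ∈ H i ∧ i = j
    · obtain ⟨hg, rfl⟩ := hg
      have e1 : π g = ⟨g, hg⟩ := hπ.apply_coe ⟨g, hg⟩
      have e2 : π (g * x) = ⟨g, hg⟩ * ⟨x, hj⟩ := hπ.apply_coe (⟨g, hg⟩ * ⟨x, hj⟩)
      have e3 := (C i).dist_mul_left ⟨g, hg⟩ 1 ⟨x, hj⟩
      rw [mul_one] at e3
      rw [e1, e2, e3, hwj]
      exact_mod_cast Nat.le_mul_of_pos_left _ K.succ_pos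
    · refine of_letter (Sum.inr ⟨j, ⟨x, hj⟩⟩) rfl ?_
      rintro ⟨hgi, b, hb⟩
      exact hg ⟨hgi, (congrArg Sigma.fst (Sum.inr_injective hb)).symm⟩

theorem IsNearestPointProjection.isLipschitz (hyp : IsHyperbolicallyEmbedded H X) {i : ι}
    {π : G → H i} (hπ : IsNearestPointProjection H X i π) :
    IsLipschitz (inducedMetric H X C hyp.symm hyp.generates) (C i) π := by
  obtain ⟨K, hK⟩ := hyp.exists_dist_le_weight C i
  have key : ∀ (L : List G) (g : G), ((C i).dist (π g) (π (g * L.prod)) : ℕ∞) ≤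
      (K + 1 : ℕ) * (L.map (weight H X C)).sum := by
    intro L
    induction L with
    | nil => intro g; simp [((C i).dist_eq_zero_iff _ _).2]
    | cons x L ih =>
      intro g
      rw [List.prod_cons, List.map_cons, List.sum_cons, mul_add, ← mul_assoc]
      refine le_trans ?_ (add_le_add (hK π hπ g x) (ih (g * x)))
      exact_mod_cast (C i).dist_triangle _ _ _
  refine ⟨(K + 1 : ℕ), fun f g => ?_⟩
  obtain ⟨L, hL, eL⟩ := exists_list H X C f g
  have h := key L f
  rw [hL, mul_inv_cancel_left, ← eL,
    ← ENat.natCast_toNat (inducedEDist_ne_top H X C hyp.symm hyp.generates f g)] at h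
  have h' : (C i).dist (π f) (π g) ≤ (K + 1) * (inducedEDist H X C f g).toNat := by
    exact_mod_cast h
  simpa [inducedMetric] using (Nat.cast_le (α := ℝ)).2 h'

end Cayley

end HypEmb

theorem mainTheorem7 {G : Type*} [Group G] {ι : Type*} (H : ι → Subgroup G) (X : Set G)
    (hyp : HypEmb.IsHyperbolicallyEmbedded H X) (C : ∀ i, HypEmb.IntMetric (H i)) (i : ι) :
    (∀ π : G → H i, HypEmb.IsNearestPointProjection H X i π →
      HypEmb.IsLipschitz (HypEmb.inducedMetric H X C hyp.symm hyp.generates) (C i) π) ∧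
    ∃ r : G → H i,
      HypEmb.IsLipschitz (HypEmb.inducedMetric H X C hyp.symm hyp.generates) (C i) r ∧
      (∀ h : H i, r (h : G) = h) ∧
      (∀ (h : H i) (g : G), r ((h : G) * g) = h * r g) := by
  refine ⟨fun π hπ => hπ.isLipschitz C hyp, ?_⟩
  obtain ⟨r, hr, hmul⟩ := HypEmb.exists_equivariant_isNearestPointProjection H X i
  exact ⟨r, hr.isLipschitz C hyp, hr.apply_coe, hmul⟩
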